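/- For a real matrix $A$ let $\|A\|_F$ be the Frobenius norm, $\|A\|$ the spectral norm, $\|A\|_0$ the number of nonzero entries, and $\|A\|_{2,\infty}$ the largest Euclidean norm of a row. A matrix $U\in\mathbb R^{p\times r}$ is called $\mu$-incoherent, written $U\in\mathcal O^{\mu}_{p,r}$, if $U^\top U=I_r$ and $\|U\|_{2,\infty}\le\sqrt{\mu r/p}$. There are universal constants $c,C>0$ such that the following holds. Let $Y=X(L^\star+S^\star)+W$ with $X,Y,W\in\mathbb R^{n\times p}$ and $L^\star,S^\star\in\mathbb R^{p\times p}$, and let $r\le\bar r$, $\bar r\ge 1$, $\mu\le\bar\mu$ and $\bar s\in\mathbb N$. Suppose that 1. $L^\star=U^\star\Sigma^\star V^{\star\top}$ with $U^\star,V^\star\in\mathcal O^{\mu}_{p,r}$ and $\Sigma^\star$ diagonal with nonnegative entries; if $r<\bar r$, suppose also that $L^\star=U\Sigma V^\top$ for some $U,V\in\mathcal O^{\bar\mu}_{p,\bar r}$ and some nonnegative diagonal $\Sigma$ (for $r=\bar r$ this is automatic); 2. $\|S^\star\|_0\le\bar s\le \dfrac{p}{8c\,\bar\mu\,\bar r^4}$;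 3. the design satisfies $\sigma_{\min}(X)\ge\sigma_{\min}>0$, $\sigma_{\max}(X)\le\sigma_{\max}$ and $\|X^\top\|_{2,\infty}\le B$, where $\sigma_{\max}(X)$ and $\sigma_{\min}(X)$ are the square roots of the largest and of the smallest eigenvalue of $X^\top X$. Let $(\widehat L,\widehat S,\widehat U,\widehat V,\widehat\Sigma)$ be any solution of $$\min_{L,S,U,V,\Sigma}\ \tfrac12\|Y-X(L+S)\|_F^2\quad\text{s.t.}\quad L=U\Sigma V^\top,\ U,V\in\mathcal O^{\bar\mu}_{p,\bar r},\ \Sigma \text{ nonnegative diagonal},\ \|S\|_0\le\bar s .$$ Then, with $\Delta_L=\widehat L-L^\star$ and $\Delta_S=\widehat S-S^\star$, $$\|\Delta_L\|_F^2+\|\Delta_S\|_F^2\le \frac{C}{\sigma_{\min}^4}\Big(\bar r\,\sigma_{\max}^2\|W\|^2+\bar s\,B^2\|W^\top\|_{2,\infty}^2\Big).$$ Here $\|W^\top\|_{2,\infty}$ is the largest Euclidean norm of a column of $W$. -/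

import Mathlib

namespace LowRankSparse

open scoped Matrix

/-- The Frobenius norm of a real matrix. -/
noncomputable def frobNorm {m n : ℕ} (A : Matrix (Fin m) (Fin n) ℝ) : ℝ :=
  open scoped Matrix.Norms.Frobenius in ‖A‖

/-- The spectral norm of a real matrix (operator norm between Euclidean spaces). -/
noncomputable def specNorm {m n : ℕ} (A : Matrix (Fin m) (Fin n) ℝ) : ℝ :=
  open scoped Matrix.Norms.L2Operator in ‖A‖

/-- The norm `‖A‖_{2,∞}`: the largest Euclidean norm of a row of `A`. -/
noncomputable def twoInftyNorm {m n : ℕ} (A : Matrix (Fin m) (Fin n) ℝ) : ℝ :=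
  ⨆ i : Fin m, ‖WithLp.toLp 2 (A i)‖

open Classical in
/-- The number `‖A‖₀` of nonzero entries of a matrix. -/
noncomputable def numNonzero {m n : ℕ} (A : Matrix (Fin m) (Fin n) ℝ) : ℕ :=
  (Finset.univ.filter fun ij : Fin m × Fin n => A ij.1 ij.2 ≠ 0).card

/-- The largest singular value of an `n × p` matrix. -/
noncomputable def sigmaMax {n p : ℕ} (X : Matrix (Fin n) (Fin p) ℝ) : ℝ :=
  (Matrix.toEuclideanLin X).singularValues 0

/-- The smallest singular value of an `n × p` matrix with `p ≥ 1`: the square root of the smallest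
eigenvalue of the `p × p` matrix `XᵀX`, i.e. the `p`-th singular value (Mathlib numbers them in
decreasing order from `0`). It vanishes if `n < p`. -/
noncomputable def sigmaMin {n p : ℕ} (X : Matrix (Fin n) (Fin p) ℝ) : ℝ :=
  (Matrix.toEuclideanLin X).singularValues (p - 1)

/-- `U` has orthonormal columns and is `μ`-incoherent. -/
def IsIncoherent {p r : ℕ} (μ : ℝ) (U : Matrix (Fin p) (Fin r) ℝ) : Prop :=
  Uᵀ * U = 1 ∧ twoInftyNorm U ≤ √(μ * r / p)

/-- `L = U Σ Vᵀ` is a singular value decomposition with `Σ = diag σ` of size `r × r`,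
both of whose factors are `μ`-incoherent. -/
def IsIncoherentSVD {p r : ℕ} (μ : ℝ) (L : Matrix (Fin p) (Fin p) ℝ)
    (U : Matrix (Fin p) (Fin r) ℝ) (σ : Fin r → ℝ) (V : Matrix (Fin p) (Fin r) ℝ) : Prop :=
  L = U * Matrix.diagonal σ * Vᵀ ∧ IsIncoherent μ U ∧ IsIncoherent μ V ∧ ∀ i, 0 ≤ σ i

/-- The least-squares objective `½ ‖Y - X (L + S)‖_F²` of multitask regression. -/
noncomputable def objective {n p : ℕ} (X Y : Matrix (Fin n) (Fin p) ℝ)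
    (L S : Matrix (Fin p) (Fin p) ℝ) : ℝ :=
  1 / 2 * frobNorm (Y - X * (L + S)) ^ 2

/-- `(L, S, U, V, Σ)` with `Σ = diag σ` solves the incoherence-constrained least-squares problem
with rank bound `r`, incoherence parameter `μ` and sparsity bound `s`. -/
def IsEstimator {n p r : ℕ} (μ : ℝ) (s : ℕ) (X Y : Matrix (Fin n) (Fin p) ℝ)
    (L S : Matrix (Fin p) (Fin p) ℝ) (U V : Matrix (Fin p) (Fin r) ℝ) (σ : Fin r → ℝ) : Prop :=
  IsIncoherentSVD μ L U σ V ∧ numNonzero S ≤ s ∧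
    ∀ (L' S' : Matrix (Fin p) (Fin p) ℝ) (U' V' : Matrix (Fin p) (Fin r) ℝ) (σ' : Fin r → ℝ),
      IsIncoherentSVD μ L' U' σ' V' → numNonzero S' ≤ s →
        objective X Y L S ≤ objective X Y L' S'

end LowRankSparse

/-! The truth is feasible, so optimality gives `‖X(Δ_L + Δ_S)‖² ≤ 2⟨Δ_L + Δ_S, XᵀW⟩` (Frobenius
norms; `frobNorm_sq_le_of_objective_le`). The left side controls both errors separately because they
are nearly orthogonal: every entry of `Δ_L` is at most `2√(μ̄ r̄/p) ‖Δ_L‖` (`abs_sub_apply_le`) and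
`Δ_S` has at most `2s̄` nonzero entries, so the sparsity hypothesis yields `|⟨Δ_L, Δ_S⟩| ≤ ½ ‖Δ_L‖
‖Δ_S‖`. The right side is linear in the errors: low rank pairs `Δ_L` with the spectral norm of
`XᵀW`, sparsity pairs `Δ_S` with its largest entry. Cauchy–Schwarz concludes. The splitting
`exists_sub_eq_mul_add_mul` serves both bounds on `Δ_L` and involves no singular values of `L`, so
no condition number appears. -/

namespace LowRankSparse

open scoped Matrix

/-! ### Extreme singular values as bounds on `‖T v‖`. -/

section SingularValues

variable {E F : Type*} [NormedAddCommGroup E] [InnerProductSpace ℝ E] [FiniteDimensional ℝ E]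
  [NormedAddCommGroup F] [InnerProductSpace ℝ F] [FiniteDimensional ℝ F]

theorem norm_sq_apply_eq_sum_singularValues (T : E →ₗ[ℝ] F) {d : ℕ}
    (hd : Module.finrank ℝ E = d) (v : E) :
    ‖T v‖ ^ 2 = ∑ i : Fin d, T.singularValues i ^ 2 *
      (T.isSymmetric_adjoint_comp_self.eigenvectorBasis hd).repr v i ^ 2 := by
  set hT := T.isSymmetric_adjoint_comp_self
  set b := hT.eigenvectorBasis hd
  have h1 : ‖T v‖ ^ 2 = inner ℝ v ((T.adjoint ∘ₗ T) v) := by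
    rw [LinearMap.comp_apply, LinearMap.adjoint_inner_right, real_inner_self_eq_norm_sq]
  rw [h1, ← b.repr.inner_map_map, PiLp.inner_apply]
  refine Finset.sum_congr rfl fun i _ => ?_
  rw [hT.eigenvectorBasis_apply_self_apply hd, T.sq_singularValues_fin hd]
  simp only [RCLike.inner_apply, conj_trivial, RCLike.ofReal_real_eq_id, id_eq]
  ring

theorem norm_apply_le_singularValues_zero_mul (T : E →ₗ[ℝ] F) (v : E) :
    ‖T v‖ ≤ T.singularValues 0 * ‖v‖ := by
  refine le_of_sq_le_sq ?_ (mul_nonneg (T.singularValues_nonneg 0) (norm_nonneg v))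
  have hv := (T.isSymmetric_adjoint_comp_self.eigenvectorBasis rfl).repr.norm_map v
  rw [norm_sq_apply_eq_sum_singularValues T rfl, mul_pow, ← hv, EuclideanSpace.real_norm_sq_eq,
    Finset.mul_sum]
  refine Finset.sum_le_sum fun i _ => ?_
  have h := T.singularValues_antitone (Nat.zero_le (i : ℕ))
  have h0 := T.singularValues_nonneg i
  gcongr

/-- In dimension zero the truncated index is `0`, which is harmless because `v = 0`. -/
theorem singularValues_last_mul_norm_le (T : E →ₗ[ℝ] F) (v : E) :
    T.singularValues (Module.finrank ℝ E - 1) * ‖v‖ ≤ ‖T v‖ := by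
  refine le_of_sq_le_sq ?_ (norm_nonneg _)
  have hv := (T.isSymmetric_adjoint_comp_self.eigenvectorBasis rfl).repr.norm_map v
  rw [norm_sq_apply_eq_sum_singularValues T rfl, mul_pow, ← hv, EuclideanSpace.real_norm_sq_eq,
    Finset.mul_sum]
  refine Finset.sum_le_sum fun i _ => ?_
  have h := T.singularValues_antitone (Nat.le_sub_one_of_lt i.2)
  have h0 := T.singularValues_nonneg (Module.finrank ℝ E - 1)
  gcongr

end SingularValues

/-! ### Matrix norms and the trace inner product. -/

section Norms

variable {k m n : ℕ}

theorem frobNorm_nonneg (A : Matrix (Fin m) (Fin n) ℝ) : 0 ≤ frobNorm A := by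
  unfold frobNorm
  open scoped Matrix.Norms.Frobenius in exact norm_nonneg A

theorem specNorm_nonneg (A : Matrix (Fin m) (Fin n) ℝ) : 0 ≤ specNorm A := by
  unfold specNorm
  open scoped Matrix.Norms.L2Operator in exact norm_nonneg A

theorem twoInftyNorm_nonneg (A : Matrix (Fin m) (Fin n) ℝ) : 0 ≤ twoInftyNorm A :=
  Real.iSup_nonneg fun _ => norm_nonneg _

theorem norm_row_le_twoInftyNorm (A : Matrix (Fin m) (Fin n) ℝ) (i : Fin m) :
    ‖WithLp.toLp 2 (A i)‖ ≤ twoInftyNorm A :=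
  le_ciSup (f := fun i => ‖WithLp.toLp 2 (A i)‖) (Set.finite_range _).bddAbove i

theorem frobNorm_sq (A : Matrix (Fin m) (Fin n) ℝ) :
    frobNorm A ^ 2 = ∑ i, ∑ j, A i j ^ 2 := by
  unfold frobNorm
  rw [Matrix.frobenius_norm_def, ← Real.sqrt_eq_rpow, Real.sq_sqrt]
  · simp
  · positivity

theorem frobNorm_sq_eq_sum_rows (A : Matrix (Fin m) (Fin n) ℝ) :
    frobNorm A ^ 2 = ∑ i, ‖WithLp.toLp 2 (A i)‖ ^ 2 := by
  simp [frobNorm_sq, EuclideanSpace.real_norm_sq_eq]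

theorem frobNorm_transpose (A : Matrix (Fin m) (Fin n) ℝ) : frobNorm Aᵀ = frobNorm A :=
  Matrix.frobenius_norm_transpose A

theorem specNorm_transpose (A : Matrix (Fin m) (Fin n) ℝ) : specNorm Aᵀ = specNorm A := by
  have h := Matrix.l2_opNorm_conjTranspose A
  rwa [Matrix.conjTranspose_eq_transpose_of_trivial] at h

theorem twoInftyNorm_le_frobNorm (A : Matrix (Fin m) (Fin n) ℝ) :
    twoInftyNorm A ≤ frobNorm A := by
  refine Real.iSup_le (fun i => le_of_sq_le_sq ?_ (frobNorm_nonneg A)) (frobNorm_nonneg A)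
  rw [frobNorm_sq_eq_sum_rows]
  exact Finset.single_le_sum (f := fun i => ‖WithLp.toLp 2 (A i)‖ ^ 2)
    (fun _ _ => sq_nonneg _) (Finset.mem_univ i)

theorem abs_mul_transpose_apply_le (A : Matrix (Fin m) (Fin k) ℝ) (B : Matrix (Fin n) (Fin k) ℝ)
    (i : Fin m) (j : Fin n) : |(A * Bᵀ) i j| ≤ twoInftyNorm A * twoInftyNorm B := by
  have h := abs_real_inner_le_norm (WithLp.toLp 2 (B j)) (WithLp.toLp 2 (A i))
  have h1 : inner ℝ (WithLp.toLp 2 (B j)) (WithLp.toLp 2 (A i)) = (A * Bᵀ) i j := by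
    simp [PiLp.inner_apply, Matrix.mul_apply]
  rw [h1] at h
  calc _ ≤ _ := h
    _ = ‖WithLp.toLp 2 (A i)‖ * ‖WithLp.toLp 2 (B j)‖ := mul_comm _ _
    _ ≤ _ := mul_le_mul (norm_row_le_twoInftyNorm A i) (norm_row_le_twoInftyNorm B j)
      (norm_nonneg _) (twoInftyNorm_nonneg A)

theorem frobNorm_mul_le_specNorm_mul (A : Matrix (Fin m) (Fin k) ℝ)
    (B : Matrix (Fin k) (Fin n) ℝ) : frobNorm (A * B) ≤ specNorm A * frobNorm B := by
  refine le_of_sq_le_sq ?_ (mul_nonneg (specNorm_nonneg A) (frobNorm_nonneg B))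
  rw [← frobNorm_transpose (A * B), ← frobNorm_transpose B, mul_pow, frobNorm_sq_eq_sum_rows,
    frobNorm_sq_eq_sum_rows, Finset.mul_sum]
  refine Finset.sum_le_sum fun j _ => ?_
  rw [← mul_pow]
  exact pow_le_pow_left₀ (norm_nonneg _) (Matrix.l2_opNorm_mulVec A (WithLp.toLp 2 (Bᵀ j))) 2

theorem frobNorm_mul_le_mul_specNorm (A : Matrix (Fin m) (Fin k) ℝ)
    (B : Matrix (Fin k) (Fin n) ℝ) : frobNorm (A * B) ≤ frobNorm A * specNorm B := by
  have h := frobNorm_mul_le_specNorm_mul Bᵀ Aᵀ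
  rwa [← Matrix.transpose_mul, frobNorm_transpose, frobNorm_transpose, specNorm_transpose,
    mul_comm (specNorm B)] at h

theorem specNorm_le_sigmaMax (X : Matrix (Fin m) (Fin n) ℝ) : specNorm X ≤ sigmaMax X :=
  ContinuousLinearMap.opNorm_le_bound _ (LinearMap.singularValues_nonneg _ 0)
    (norm_apply_le_singularValues_zero_mul (Matrix.toEuclideanLin X))

theorem sigmaMin_mul_frobNorm_le (X : Matrix (Fin m) (Fin k) ℝ) (A : Matrix (Fin k) (Fin n) ℝ) :
    sigmaMin X * frobNorm A ≤ frobNorm (X * A) := by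
  have h0 : 0 ≤ sigmaMin X := LinearMap.singularValues_nonneg _ _
  refine le_of_sq_le_sq ?_ (frobNorm_nonneg _)
  rw [← frobNorm_transpose (X * A), ← frobNorm_transpose A, mul_pow, frobNorm_sq_eq_sum_rows,
    frobNorm_sq_eq_sum_rows, Finset.mul_sum]
  refine Finset.sum_le_sum fun j _ => ?_
  rw [← mul_pow]
  have h := singularValues_last_mul_norm_le (Matrix.toEuclideanLin X) (WithLp.toLp 2 (Aᵀ j))
  rw [finrank_euclideanSpace_fin] at h
  exact pow_le_pow_left₀ (mul_nonneg h0 (norm_nonneg _)) h 2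

theorem specNorm_le_one_of_transpose_mul_self {U : Matrix (Fin m) (Fin n) ℝ}
    (hU : Uᵀ * U = 1) : specNorm U ≤ 1 := by
  have h := Matrix.l2_opNorm_conjTranspose_mul_self U
  rw [Matrix.conjTranspose_eq_transpose_of_trivial, hU, ← Matrix.diagonal_one,
    Matrix.l2_opNorm_diagonal] at h
  -- Only an inequality: for `n = 0` this norm is `0`.
  have h1 : ‖(fun _ : Fin n => (1 : ℝ))‖ ≤ 1 :=
    (pi_norm_le_iff_of_nonneg zero_le_one).2 fun _ => by simp
  have h2 : specNorm U * specNorm U ≤ 1 := h.symm.trans_le h1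
  nlinarith [specNorm_nonneg U]

theorem specNorm_le_one_of_projection {P : Matrix (Fin n) (Fin n) ℝ}
    (hP : Pᵀ * P = P) : specNorm P ≤ 1 := by
  have h := Matrix.l2_opNorm_conjTranspose_mul_self P
  rw [Matrix.conjTranspose_eq_transpose_of_trivial, hP] at h
  have h2 : specNorm P = specNorm P * specNorm P := h
  nlinarith [specNorm_nonneg P]

theorem trace_transpose_mul (A B : Matrix (Fin m) (Fin n) ℝ) :
    (Aᵀ * B).trace = ∑ ij : Fin m × Fin n, A ij.1 ij.2 * B ij.1 ij.2 := by
  rw [Fintype.sum_prod_type_right]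
  simp [Matrix.trace, Matrix.mul_apply]

theorem frobNorm_sq_eq_sum_prod (A : Matrix (Fin m) (Fin n) ℝ) :
    frobNorm A ^ 2 = ∑ ij : Fin m × Fin n, A ij.1 ij.2 ^ 2 := by
  rw [frobNorm_sq, Fintype.sum_prod_type]

theorem trace_transpose_mul_self (A : Matrix (Fin m) (Fin n) ℝ) :
    (Aᵀ * A).trace = frobNorm A ^ 2 := by
  rw [trace_transpose_mul, frobNorm_sq_eq_sum_prod]
  exact Finset.sum_congr rfl fun _ _ => (sq _).symm

theorem abs_trace_transpose_mul_le (A B : Matrix (Fin m) (Fin n) ℝ) :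
    |(Aᵀ * B).trace| ≤ frobNorm A * frobNorm B := by
  refine abs_le_of_sq_le_sq ?_ (mul_nonneg (frobNorm_nonneg A) (frobNorm_nonneg B))
  rw [trace_transpose_mul, mul_pow, frobNorm_sq_eq_sum_prod, frobNorm_sq_eq_sum_prod]
  exact Finset.sum_mul_sq_le_sq_mul_sq _ _ _

theorem frobNorm_add_sq (A B : Matrix (Fin m) (Fin n) ℝ) :
    frobNorm (A + B) ^ 2 = frobNorm A ^ 2 + 2 * (Aᵀ * B).trace + frobNorm B ^ 2 := by
  simp only [frobNorm_sq_eq_sum_prod, trace_transpose_mul, Finset.mul_sum,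
    ← Finset.sum_add_distrib, Matrix.add_apply]
  exact Finset.sum_congr rfl fun _ _ => by ring

theorem frobNorm_sub_sq (A B : Matrix (Fin m) (Fin n) ℝ) :
    frobNorm (A - B) ^ 2 = frobNorm A ^ 2 - 2 * (Aᵀ * B).trace + frobNorm B ^ 2 := by
  simp only [frobNorm_sq_eq_sum_prod, trace_transpose_mul, Finset.mul_sum,
    ← Finset.sum_add_distrib, ← Finset.sum_sub_distrib, Matrix.sub_apply]
  exact Finset.sum_congr rfl fun _ _ => by ring

theorem frobNorm_of_transpose_mul_self {U : Matrix (Fin m) (Fin n) ℝ} (hU : Uᵀ * U = 1) :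
    frobNorm U = √n := by
  rw [← Real.sqrt_sq (frobNorm_nonneg U), ← trace_transpose_mul_self, hU]
  simp

/-- Cauchy–Schwarz on the support of `S`, where `M` has squared mass at most `s * b ^ 2`. It serves
both the near-orthogonality of the errors and the noise term. -/
theorem abs_trace_transpose_mul_le_of_numNonzero_le {S M : Matrix (Fin m) (Fin n) ℝ} {s : ℕ}
    {b : ℝ} (hS : numNonzero S ≤ s) (hM : ∀ i j, |M i j| ≤ b) (hb : 0 ≤ b) :
    |(Sᵀ * M).trace| ≤ √s * b * frobNorm S := by
  classical
  refine abs_le_of_sq_le_sq ?_ (mul_nonneg (by positivity) (frobNorm_nonneg S))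
  set t := Finset.univ.filter fun ij : Fin m × Fin n => S ij.1 ij.2 ≠ 0 with ht
  have hcard : t.card ≤ s := by
    unfold numNonzero at hS
    convert hS
  have h1 : (Sᵀ * M).trace = ∑ ij ∈ t, S ij.1 ij.2 * M ij.1 ij.2 := by
    rw [trace_transpose_mul, ht, Finset.sum_filter_of_ne]
    exact fun ij _ h => left_ne_zero_of_mul h
  have h2 : ∑ ij ∈ t, S ij.1 ij.2 ^ 2 ≤ frobNorm S ^ 2 := by
    rw [frobNorm_sq_eq_sum_prod]
    exact Finset.sum_le_univ_sum_of_nonneg fun _ => sq_nonneg _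
  have h3 : ∑ ij ∈ t, M ij.1 ij.2 ^ 2 ≤ s * b ^ 2 := by
    calc _ ≤ ∑ _ij ∈ t, b ^ 2 := Finset.sum_le_sum fun ij _ => by
            rw [← sq_abs]; exact pow_le_pow_left₀ (abs_nonneg _) (hM _ _) 2
      _ = t.card * b ^ 2 := by rw [Finset.sum_const, nsmul_eq_mul]
      _ ≤ s * b ^ 2 := by gcongr
  calc (Sᵀ * M).trace ^ 2 ≤ (∑ ij ∈ t, S ij.1 ij.2 ^ 2) * ∑ ij ∈ t, M ij.1 ij.2 ^ 2 := by
        rw [h1]; exact Finset.sum_mul_sq_le_sq_mul_sq _ _ _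
    _ ≤ frobNorm S ^ 2 * (s * b ^ 2) :=
        mul_le_mul h2 h3 (Finset.sum_nonneg fun _ _ => sq_nonneg _) (sq_nonneg _)
    _ = (√s * b * frobNorm S) ^ 2 := by
        rw [mul_pow, mul_pow, Real.sq_sqrt (Nat.cast_nonneg s)]; ring

theorem numNonzero_sub_le (A B : Matrix (Fin m) (Fin n) ℝ) :
    numNonzero (A - B) ≤ numNonzero A + numNonzero B := by
  classical
  unfold numNonzero
  refine (Finset.card_le_card ?_).trans (Finset.card_union_le _ _)
  intro ij
  simp only [Finset.mem_union, Finset.mem_filter_univ]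
  intro h
  by_contra! h'
  exact h (by rw [Matrix.sub_apply, h'.1, h'.2, sub_self])

end Norms

/-! ### Differences of incoherent low-rank matrices. -/

section LowRank

variable {p r : ℕ}

/-- The difference of two matrices of rank at most `r` splits into a part with the column space of
one of them and a part with the row space of the other. -/
theorem exists_sub_eq_mul_add_mul {U V U' V' : Matrix (Fin p) (Fin r) ℝ} (σ σ' : Fin r → ℝ)
    (hU : Uᵀ * U = 1) (hV' : V'ᵀ * V' = 1) {Δ : Matrix (Fin p) (Fin p) ℝ}
    (hΔ : Δ = U' * Matrix.diagonal σ' * V'ᵀ - U * Matrix.diagonal σ * Vᵀ) :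
    ∃ (A : Matrix (Fin r) (Fin p) ℝ) (D : Matrix (Fin p) (Fin r) ℝ),
      Δ = U * A + D * V'ᵀ ∧ frobNorm A ≤ frobNorm Δ ∧ frobNorm D ≤ frobNorm Δ := by
  -- The projection `Q` kills the term with left factor `U`, so `Q * Δ` has its rows in the span of
  -- the columns of `V'` and is fixed by `V' * V'ᵀ`. The splitting is `Δ = U * Uᵀ * Δ + Q * Δ`.
  set Q : Matrix (Fin p) (Fin p) ℝ := 1 - U * Uᵀ with hQ
  have hUQ : Q * U = 0 := by
    rw [hQ, Matrix.sub_mul, Matrix.one_mul, Matrix.mul_assoc, hU, Matrix.mul_one, sub_self]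
  have hQQ : Qᵀ * Q = Q := by
    have ht : Qᵀ = Q := by simp [hQ]
    rw [ht]
    nth_rewrite 2 [hQ]
    rw [Matrix.mul_sub, Matrix.mul_one, ← Matrix.mul_assoc, hUQ, Matrix.zero_mul, sub_zero]
  have hQΔ : Q * Δ = Q * U' * Matrix.diagonal σ' * V'ᵀ := by
    rw [hΔ, Matrix.mul_sub, ← Matrix.mul_assoc, ← Matrix.mul_assoc, ← Matrix.mul_assoc,
      ← Matrix.mul_assoc, hUQ, Matrix.zero_mul, Matrix.zero_mul, sub_zero]
  refine ⟨Uᵀ * Δ, Q * Δ * V', ?_, ?_, ?_⟩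
  · have h : Q * Δ * V' * V'ᵀ = Q * Δ := by
      rw [hQΔ, Matrix.mul_assoc _ V'ᵀ V', hV', Matrix.mul_one]
    rw [h, hQ, Matrix.sub_mul, Matrix.one_mul, ← Matrix.mul_assoc]
    abel
  · refine (frobNorm_mul_le_specNorm_mul _ _).trans ?_
    rw [specNorm_transpose]
    exact mul_le_of_le_one_left (frobNorm_nonneg Δ) (specNorm_le_one_of_transpose_mul_self hU)
  · refine (frobNorm_mul_le_mul_specNorm _ _).trans ((mul_le_of_le_one_right (frobNorm_nonneg _)
      (specNorm_le_one_of_transpose_mul_self hV')).trans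
        ((frobNorm_mul_le_specNorm_mul _ _).trans ?_))
    exact mul_le_of_le_one_left (frobNorm_nonneg Δ) (specNorm_le_one_of_projection hQQ)

/-- In each part of the splitting, an entry is the inner product of an incoherent row of `U` or `V'`
with a vector of norm at most that of the difference. -/
theorem abs_sub_apply_le {μ : ℝ} {L L' : Matrix (Fin p) (Fin p) ℝ}
    {U V U' V' : Matrix (Fin p) (Fin r) ℝ} {σ σ' : Fin r → ℝ}
    (h : IsIncoherentSVD μ L U σ V) (h' : IsIncoherentSVD μ L' U' σ' V') (i j : Fin p) :
    |(L' - L) i j| ≤ 2 * √(μ * r / p) * frobNorm (L' - L) := by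
  obtain ⟨A, D, hAD, hA, hD⟩ := exists_sub_eq_mul_add_mul σ σ' h.2.1.1 h'.2.2.1.1
    (show L' - L = _ by rw [h'.1, h.1])
  have h1 : |(U * A) i j| ≤ √(μ * r / p) * frobNorm (L' - L) := by
    have := abs_mul_transpose_apply_le U Aᵀ i j
    rw [Matrix.transpose_transpose] at this
    refine this.trans (mul_le_mul h.2.1.2 ((twoInftyNorm_le_frobNorm _).trans ?_)
      (twoInftyNorm_nonneg _) (Real.sqrt_nonneg _))
    rwa [frobNorm_transpose]
  have h2 : |(D * V'ᵀ) i j| ≤ frobNorm (L' - L) * √(μ * r / p) :=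
    (abs_mul_transpose_apply_le D V' i j).trans
      (mul_le_mul ((twoInftyNorm_le_frobNorm _).trans hD) h'.2.2.1.2
        (twoInftyNorm_nonneg _) (frobNorm_nonneg _))
  calc |(L' - L) i j| = |(U * A) i j + (D * V'ᵀ) i j| := by rw [← Matrix.add_apply, ← hAD]
    _ ≤ |(U * A) i j| + |(D * V'ᵀ) i j| := abs_add_le _ _
    _ ≤ _ := by linarith

/-- Each part of the splitting moves its orthonormal factor onto `M`; since that factor has
Frobenius norm `√r`, this costs `√r * specNorm M`. -/
theorem abs_trace_sub_transpose_mul_le {μ : ℝ} {L L' : Matrix (Fin p) (Fin p) ℝ}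
    {U V U' V' : Matrix (Fin p) (Fin r) ℝ} {σ σ' : Fin r → ℝ}
    (h : IsIncoherentSVD μ L U σ V) (h' : IsIncoherentSVD μ L' U' σ' V')
    (M : Matrix (Fin p) (Fin p) ℝ) :
    |((L' - L)ᵀ * M).trace| ≤ 2 * √r * specNorm M * frobNorm (L' - L) := by
  have hU := h.2.1.1
  have hV' := h'.2.2.1.1
  obtain ⟨A, D, hAD, hA, hD⟩ := exists_sub_eq_mul_add_mul σ σ' hU hV'
    (show L' - L = _ by rw [h'.1, h.1])
  have h0 : ((L' - L)ᵀ * M).trace = (Aᵀ * (Uᵀ * M)).trace + (Dᵀ * (M * V')).trace := by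
    nth_rewrite 1 [hAD]
    rw [Matrix.transpose_add, Matrix.add_mul, Matrix.trace_add, Matrix.transpose_mul,
      Matrix.transpose_mul, Matrix.transpose_transpose, Matrix.mul_assoc, Matrix.mul_assoc,
      Matrix.trace_mul_comm V', Matrix.mul_assoc]
  have hs := specNorm_nonneg M
  have h1 : |(Aᵀ * (Uᵀ * M)).trace| ≤ frobNorm (L' - L) * (√r * specNorm M) := by
    refine (abs_trace_transpose_mul_le _ _).trans
      (mul_le_mul hA ?_ (frobNorm_nonneg _) (frobNorm_nonneg _))
    rw [← frobNorm_of_transpose_mul_self hU, ← frobNorm_transpose U]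
    exact frobNorm_mul_le_mul_specNorm _ _
  have h2 : |(Dᵀ * (M * V')).trace| ≤ frobNorm (L' - L) * (specNorm M * √r) := by
    refine (abs_trace_transpose_mul_le _ _).trans
      (mul_le_mul hD ?_ (frobNorm_nonneg _) (frobNorm_nonneg _))
    rw [← frobNorm_of_transpose_mul_self hV']
    exact frobNorm_mul_le_specNorm_mul _ _
  rw [h0]
  refine (abs_add_le _ _).trans ?_
  linarith

theorem IsIncoherent.mono {μ μ' : ℝ} (hμ : μ ≤ μ') {U : Matrix (Fin p) (Fin r) ℝ}
    (h : IsIncoherent μ U) : IsIncoherent μ' U :=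
  ⟨h.1, h.2.trans (Real.sqrt_le_sqrt (by gcongr))⟩

theorem IsIncoherentSVD.mono {μ μ' : ℝ} (hμ : μ ≤ μ') {L : Matrix (Fin p) (Fin p) ℝ}
    {U V : Matrix (Fin p) (Fin r) ℝ} {σ : Fin r → ℝ} (h : IsIncoherentSVD μ L U σ V) :
    IsIncoherentSVD μ' L U σ V :=
  ⟨h.1, h.2.1.mono hμ, h.2.2.1.mono hμ, h.2.2.2⟩

theorem sqrt_two_mul_mul_sqrt_le {s : ℕ} {μ : ℝ} (hr : 1 ≤ r)
    (hs : (s : ℝ) ≤ p / (8 * 4 * μ * (r : ℝ) ^ 4)) :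
    √((2 * s : ℕ) : ℝ) * (2 * √(μ * r / p)) ≤ 1 / 2 := by
  -- For `s = 0` the signs of `μ` and `p` are unknown; for `s > 0` the bound `hs` forces both to be
  -- positive.
  rcases Nat.eq_zero_or_pos s with rfl | hs0
  · simp
  have hs1 : (0 : ℝ) < s := by exact_mod_cast hs0
  have hr1 : (1 : ℝ) ≤ r := by exact_mod_cast hr
  have hr4 : (r : ℝ) ≤ (r : ℝ) ^ 4 := le_self_pow₀ hr1 (by norm_num)
  have hq : 0 < (p : ℝ) / (8 * 4 * μ * (r : ℝ) ^ 4) := hs1.trans_le hs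
  have hp : (0 : ℝ) < p := by
    refine lt_of_le_of_ne (Nat.cast_nonneg p) fun h => ?_
    rw [← h, zero_div] at hq
    exact lt_irrefl _ hq
  have hden : 0 < 8 * 4 * μ * (r : ℝ) ^ 4 := (div_pos_iff_of_pos_left hp).1 hq
  have hμ : 0 < μ := by
    have : 0 < 8 * 4 * μ := pos_of_mul_pos_left hden (by positivity)
    linarith
  rw [le_div_iff₀ hden] at hs
  have key : (2 * s : ℝ) * (4 * (μ * r / p)) ≤ 1 / 4 := by
    rw [← mul_div_assoc, ← mul_div_assoc, div_le_iff₀ hp]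
    have : (s : ℝ) * (μ * r) ≤ s * (μ * (r : ℝ) ^ 4) := by gcongr
    linarith
  refine le_of_sq_le_sq ?_ (by norm_num)
  rw [mul_pow, mul_pow, Real.sq_sqrt (Nat.cast_nonneg _), Real.sq_sqrt (by positivity)]
  push_cast
  linarith

end LowRank

/-! ### From the basic inequality to the error bound. -/

theorem sq_add_sq_le_of_mul_le {a b α β t : ℝ} (ht : 0 < t)
    (h : t ^ 2 / 2 * (a ^ 2 + b ^ 2) ≤ 2 * (α * a + β * b)) :
    a ^ 2 + b ^ 2 ≤ 16 * (1 / t ^ 4 * (α ^ 2 + β ^ 2)) := by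
  have h1 : (α * a + β * b) ^ 2 ≤ (α ^ 2 + β ^ 2) * (a ^ 2 + b ^ 2) := by
    nlinarith [sq_nonneg (α * b - β * a)]
  set T := a ^ 2 + b ^ 2
  have hT : 0 ≤ T := by positivity
  rcases hT.eq_or_lt with h0 | h0
  · rw [← h0]; positivity
  -- Squaring and Cauchy–Schwarz leave one surplus factor `T`, cancelled next.
  have h2 : (t ^ 2 / 2 * T) ^ 2 ≤ 4 * ((α ^ 2 + β ^ 2) * T) :=
    (pow_le_pow_left₀ (by positivity) h 2).trans (by linarith)
  have h3 : t ^ 4 * T ≤ 16 * (α ^ 2 + β ^ 2) := by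
    refine le_of_mul_le_mul_right ?_ h0
    linarith
  rw [one_div, mul_left_comm, inv_mul_eq_div, le_div_iff₀ (by positivity)]
  linarith

theorem frobNorm_sq_le_of_objective_le {n p : ℕ} {X Y W : Matrix (Fin n) (Fin p) ℝ}
    {L S L' S' : Matrix (Fin p) (Fin p) ℝ} (hY : Y = X * (L + S) + W)
    (h : objective X Y L' S' ≤ objective X Y L S) :
    frobNorm (X * ((L' - L) + (S' - S))) ^ 2 ≤
      2 * (((L' - L)ᵀ * (Xᵀ * W)).trace + ((S' - S)ᵀ * (Xᵀ * W)).trace) := by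
  have h1 : Y - X * (L + S) = W := by rw [hY]; abel
  have h2 : Y - X * (L' + S') = W - X * ((L' - L) + (S' - S)) := by
    rw [hY]; simp only [Matrix.mul_add, Matrix.mul_sub]; abel
  have h3 : (Wᵀ * (X * ((L' - L) + (S' - S)))).trace =
      ((L' - L)ᵀ * (Xᵀ * W)).trace + ((S' - S)ᵀ * (Xᵀ * W)).trace := by
    rw [← Matrix.trace_add, ← add_mul, ← Matrix.transpose_add, ← Matrix.trace_transpose]
    simp [Matrix.transpose_mul, Matrix.mul_assoc]
  unfold objective at h
  rw [h1, h2, frobNorm_sub_sq, h3] at h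
  linarith

theorem frobNorm_sq_add_frobNorm_sq_le {n p r s : ℕ} {μ t σ B : ℝ}
    {X Y W : Matrix (Fin n) (Fin p) ℝ} {L S L' S' : Matrix (Fin p) (Fin p) ℝ}
    {U V U' V' : Matrix (Fin p) (Fin r) ℝ} {σ₀ σ₁ : Fin r → ℝ} (hr : 1 ≤ r)
    (hY : Y = X * (L + S) + W) (ht : 0 < t) (hmin : t ≤ sigmaMin X) (hmax : sigmaMax X ≤ σ)
    (hB : twoInftyNorm Xᵀ ≤ B) (hL : IsIncoherentSVD μ L U σ₀ V) (hS : numNonzero S ≤ s)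
    (hs : (s : ℝ) ≤ p / (8 * 4 * μ * (r : ℝ) ^ 4))
    (hE : IsEstimator μ s X Y L' S' U' V' σ₁) :
    frobNorm (L' - L) ^ 2 + frobNorm (S' - S) ^ 2 ≤
      64 * (1 / t ^ 4 * (r * σ ^ 2 * specNorm W ^ 2 + s * B ^ 2 * twoInftyNorm Wᵀ ^ 2)) := by
  obtain ⟨hL', hS', hopt⟩ := hE
  set a := frobNorm (L' - L) with ha
  set b := frobNorm (S' - S) with hb
  have ha0 : 0 ≤ a := frobNorm_nonneg _
  have hb0 : 0 ≤ b := frobNorm_nonneg _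
  have hW0 := specNorm_nonneg W
  have hw0 := twoInftyNorm_nonneg Wᵀ
  have hB0 : 0 ≤ B := (twoInftyNorm_nonneg _).trans hB
  have hσ : specNorm X ≤ σ := (specNorm_le_sigmaMax X).trans hmax
  have hσ0 : 0 ≤ σ := (specNorm_nonneg X).trans hσ
  have hΔS : numNonzero (S' - S) ≤ 2 * s := (numNonzero_sub_le _ _).trans (by omega)
  have hsep : |((S' - S)ᵀ * (L' - L)).trace| ≤ 1 / 2 * a * b := by
    refine (abs_trace_transpose_mul_le_of_numNonzero_le hΔS (abs_sub_apply_le hL hL')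
      (by positivity)).trans ?_
    rw [← mul_assoc]
    exact mul_le_mul_of_nonneg_right
      (mul_le_mul_of_nonneg_right (sqrt_two_mul_mul_sqrt_le hr hs) ha0) hb0
  have hlow : t ^ 2 / 2 * (a ^ 2 + b ^ 2) ≤ frobNorm (X * ((L' - L) + (S' - S))) ^ 2 := by
    have h1 : t * frobNorm ((L' - L) + (S' - S)) ≤ frobNorm (X * ((L' - L) + (S' - S))) :=
      (mul_le_mul_of_nonneg_right hmin (frobNorm_nonneg _)).trans (sigmaMin_mul_frobNorm_le _ _)
    have h2 := pow_le_pow_left₀ (mul_nonneg ht.le (frobNorm_nonneg _)) h1 2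
    refine le_trans ?_ h2
    rw [mul_pow, add_comm (L' - L), frobNorm_add_sq, ← ha, ← hb, div_mul_eq_mul_div,
      mul_div_assoc]
    refine mul_le_mul_of_nonneg_left ?_ (sq_nonneg t)
    -- `a² + b² - ab ≥ (a² + b²) / 2`.
    nlinarith [neg_le_of_abs_le hsep, sq_nonneg (a - b)]
  have hspec : specNorm (Xᵀ * W) ≤ σ * specNorm W := by
    refine (Matrix.l2_opNorm_mul Xᵀ W).trans ?_
    have : specNorm Xᵀ ≤ σ := by rwa [specNorm_transpose]
    exact mul_le_mul_of_nonneg_right this hW0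
  have hentry : ∀ i j, |(Xᵀ * W) i j| ≤ B * twoInftyNorm Wᵀ := fun i j => by
    have := abs_mul_transpose_apply_le Xᵀ Wᵀ i j
    rw [Matrix.transpose_transpose] at this
    exact this.trans (mul_le_mul_of_nonneg_right hB hw0)
  have hup1 : ((L' - L)ᵀ * (Xᵀ * W)).trace ≤ 2 * √r * (σ * specNorm W) * a :=
    (le_abs_self _).trans ((abs_trace_sub_transpose_mul_le hL hL' _).trans (by gcongr))
  have hup2 : ((S' - S)ᵀ * (Xᵀ * W)).trace ≤ √((2 * s : ℕ) : ℝ) * (B * twoInftyNorm Wᵀ) * b :=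
    (le_abs_self _).trans
      (abs_trace_transpose_mul_le_of_numNonzero_le hΔS hentry (by positivity))
  have hbasic := frobNorm_sq_le_of_objective_le hY (hopt L S U V σ₀ hL hS)
  have hfin := sq_add_sq_le_of_mul_le ht
    (hlow.trans (hbasic.trans (mul_le_mul_of_nonneg_left (add_le_add hup1 hup2) zero_le_two)))
  have h1 : (2 * √(r : ℝ) * (σ * specNorm W)) ^ 2 = 4 * (r * σ ^ 2 * specNorm W ^ 2) := by
    rw [mul_pow, mul_pow, Real.sq_sqrt (Nat.cast_nonneg r)]; ring
  have h2 : (√((2 * s : ℕ) : ℝ) * (B * twoInftyNorm Wᵀ)) ^ 2 =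
      2 * (s * B ^ 2 * twoInftyNorm Wᵀ ^ 2) := by
    rw [mul_pow, Real.sq_sqrt (Nat.cast_nonneg _)]; push_cast; ring
  rw [h1, h2] at hfin
  -- The factor 16 meets 4 and 2 in the two terms; raising the 2 to 4 gives 64.
  refine hfin.trans ?_
  have h3 : 0 ≤ (s : ℝ) * B ^ 2 * twoInftyNorm Wᵀ ^ 2 := by positivity
  rw [mul_left_comm, mul_left_comm 64]
  exact mul_le_mul_of_nonneg_left (by linarith) (by positivity)

end LowRankSparse

theorem mainTheorem12 :
    ∃ c > (0 : ℝ), ∃ C > (0 : ℝ),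
      ∀ (n p r rbar sbar : ℕ) (μ μbar σmin σmax B : ℝ)
        (X Y W : Matrix (Fin n) (Fin p) ℝ)
        (Lstar Sstar : Matrix (Fin p) (Fin p) ℝ)
        (Ustar Vstar : Matrix (Fin p) (Fin r) ℝ) (σstar : Fin r → ℝ)
        (Lhat Shat : Matrix (Fin p) (Fin p) ℝ)
        (Uhat Vhat : Matrix (Fin p) (Fin rbar) ℝ) (σhat : Fin rbar → ℝ),
        1 ≤ rbar → r ≤ rbar → μ ≤ μbar →
        -- the observation model and the design
        Y = X * (Lstar + Sstar) + W →
        0 < σmin → σmin ≤ LowRankSparse.sigmaMin X → LowRankSparse.sigmaMax X ≤ σmax →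
        LowRankSparse.twoInftyNorm X.transpose ≤ B →
        -- the structure of the ground truth
        LowRankSparse.IsIncoherentSVD μ Lstar Ustar σstar Vstar →
        LowRankSparse.numNonzero Sstar ≤ sbar →
        (sbar : ℝ) ≤ p / (8 * c * μbar * (rbar : ℝ) ^ 4) →
        -- if the rank is overestimated, the ground truth still meets the constraints
        (r < rbar → ∃ (U V : Matrix (Fin p) (Fin rbar) ℝ) (σ : Fin rbar → ℝ),
          LowRankSparse.IsIncoherentSVD μbar Lstar U σ V) →
        LowRankSparse.IsEstimator μbar sbar X Y Lhat Shat Uhat Vhat σhat →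
        LowRankSparse.frobNorm (Lhat - Lstar) ^ 2 + LowRankSparse.frobNorm (Shat - Sstar) ^ 2 ≤
          C * (1 / σmin ^ 4 * (rbar * σmax ^ 2 * LowRankSparse.specNorm W ^ 2 +
            sbar * B ^ 2 * LowRankSparse.twoInftyNorm W.transpose ^ 2)) := by
  -- With `c = 4`, the square of the overlap factor, `8 * s * μ * r / p`, is at most `1 / 4`; only
  -- `r ≤ r ^ 4` is needed.
  refine ⟨4, by norm_num, 64, by norm_num, ?_⟩
  intro n p r rbar sbar μ μbar σmin σmax B X Y W Lstar Sstar Ustar Vstar σstar Lhat Shat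
    Uhat Vhat σhat hrbar hr hμ hY hpos hmin hmax hB hL hS hs hover hE
  -- The truth must be feasible at rank exactly `rbar` to compete with the estimator.
  obtain ⟨U, V, σ, hL'⟩ : ∃ (U V : Matrix (Fin p) (Fin rbar) ℝ) (σ : Fin rbar → ℝ),
      LowRankSparse.IsIncoherentSVD μbar Lstar U σ V := by
    rcases hr.lt_or_eq with h | rfl
    · exact hover h
    · exact ⟨Ustar, Vstar, σstar, hL.mono hμ⟩
  exact LowRankSparse.frobNorm_sq_add_frobNorm_sq_le hrbar hY hpos hmin hmax hB hL' hS hs hE
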